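/- Let $\mathfrak h$ be a three-dimensional solvable non-abelian real Lie algebra, and let $T^*\mathfrak h=\mathfrak h\ltimes_{\mathrm{ad}^*}\mathfrak h^*$ be its cotangent Lie algebra, i.e. the vector space $\mathfrak h\oplus\mathfrak h^*$ with the bracket $$[(x,\varphi),(x',\varphi')]=\big([x,x'],\ \mathrm{ad}^*(x)\varphi'-\mathrm{ad}^*(x')\varphi\big),\qquad (\mathrm{ad}^*(x)\varphi)(y)=-\varphi([x,y]).$$ A complex structure on a real Lie algebra $\mathfrak g$ is a linear map $J:\mathfrak g\to\mathfrak g$ with $J^2=-I$ and $[Jx,Jy]-[x,y]-J[Jx,y]-J[x,Jy]=0$ for all $x,y\in\mathfrak g$. If $T^*\mathfrak h$ admits a complex structure, then $\mathfrak h$ is isomorphic to one of the following Lie algebras (in the descriptions by a basis $e_1,e_2,e_3$, brackets of basis vectors that are neither listed nor determined by skew-symmetry are zero): - the Heisenberg algebra $\mathfrak h_1$: $[e_1,e_2]=e_3$; - $\mathbb R\times\mathfrak{aff}(\mathbb R)$, where $\mathfrak{aff}(\mathbb R)$ is the two-dimensional Lie algebra with basis $x,y$ and $[x,y]=y$; -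 $\mathfrak r_{3,1}$: $[e_1,e_2]=e_2,\ [e_1,e_3]=e_3$; - $\mathfrak r_{3,-1}$: $[e_1,e_2]=e_2,\ [e_1,e_3]=-e_3$; - $\mathfrak r'_{3,\eta}$ for some real $\eta\ge 0$: $[e_1,e_2]=\eta e_2-e_3,\ [e_1,e_3]=e_2+\eta e_3$. -/

import Mathlib

/-! ### Semidirect products with a representation, and the cotangent Lie algebra -/

/-- A real vector space `V`, regarded as an abelian Lie algebra. -/
def AbelianLie (V : Type*) : Type _ := V

namespace AbelianLie

instance {V : Type*} [AddCommGroup V] : AddCommGroup (AbelianLie V) :=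
  inferInstanceAs (AddCommGroup V)

instance {V : Type*} [AddCommGroup V] [Module ℝ V] : Module ℝ (AbelianLie V) :=
  inferInstanceAs (Module ℝ V)

instance {V : Type*} [AddCommGroup V] : LieRing (AbelianLie V) where
  bracket _ _ := 0
  add_lie _ _ _ := (add_zero 0).symm
  lie_add _ _ _ := (add_zero 0).symm
  lie_self _ := rfl
  leibniz_lie _ _ _ := (add_zero 0).symm

instance {V : Type*} [AddCommGroup V] [Module ℝ V] : LieAlgebra ℝ (AbelianLie V) where
  lie_smul t _ _ := (smul_zero t).symm

/-- The action of a Lie algebra `L` on an `L`-module `V` (that is, on the space of a representation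
of `L`), viewed as an action on the abelian Lie algebra `V` by derivations. -/
def derivationOfRep (L V : Type*) [LieRing L] [LieAlgebra ℝ L] [AddCommGroup V] [Module ℝ V]
    [LieRingModule L V] [LieModule ℝ L V] :
    L →ₗ⁅ℝ⁆ LieDerivation ℝ (AbelianLie V) (AbelianLie V) where
  toFun x :=
    { toFun := fun v => (⁅x, (v : V)⁆ : V)
      map_add' := fun v w => lie_add (M := V) x v w
      map_smul' := fun t v => lie_smul (M := V) t x v
      leibniz' := fun _ _ => (lie_zero (M := V) x).trans (sub_zero (0 : V)).symm }
  map_add' x y := by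
    ext v
    exact add_lie (M := V) x y v
  map_smul' t x := by
    ext v
    exact smul_lie (M := V) t x v
  map_lie' := by
    intro x y
    ext v
    exact lie_lie (M := V) x y v

end AbelianLie

/-- The semidirect product `L ⋉ V` of a Lie algebra `L` with the space `V` of a representation of `L`
(`V` being given the zero bracket):
`[(x, v), (x', v')] = ([x, x'], x · v' - x' · v)`.
The component in `L` is `.right` and the component in `V` is `.left`. -/
abbrev RepSemidirect (L V : Type*) [LieRing L] [LieAlgebra ℝ L] [AddCommGroup V] [Module ℝ V]
    [LieRingModule L V] [LieModule ℝ L V] : Type _ :=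
  LieAlgebra.SemiDirectSum (AbelianLie V) L (AbelianLie.derivationOfRep L V)

/-- The cotangent Lie algebra `T*L = L ⋉_{ad*} L*`. The action of `L` on its dual space is the
coadjoint representation `(ad*(x) φ)(y) = -φ([x, y])`, see `Module.Dual.lie_apply`. -/
abbrev CotangentLie (L : Type*) [LieRing L] [LieAlgebra ℝ L] : Type _ :=
  RepSemidirect L (Module.Dual ℝ L)

/-! ### Complex structures -/

/-- The Nijenhuis tensor `N_J(x, y) = [Jx, Jy] - [x, y] - J[Jx, y] - J[x, Jy]`. -/
def nijenhuis {𝔤 : Type*} [LieRing 𝔤] [LieAlgebra ℝ 𝔤] (J : 𝔤 →ₗ[ℝ] 𝔤) (x y : 𝔤) : 𝔤 :=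
  ⁅J x, J y⁆ - ⁅x, y⁆ - J ⁅J x, y⁆ - J ⁅x, J y⁆

/-- A complex structure on a real Lie algebra: an endomorphism `J` of the underlying vector space
with `J² = -I` and vanishing Nijenhuis tensor. -/
structure IsComplexStructure {𝔤 : Type*} [LieRing 𝔤] [LieAlgebra ℝ 𝔤] (J : 𝔤 →ₗ[ℝ] 𝔤) :
    Prop where
  sq_eq_neg : ∀ x, J (J x) = -x
  integrable : ∀ x y, nijenhuis J x y = 0

/-- A real Lie algebra admits a complex structure. -/
def AdmitsComplexStructure (𝔤 : Type*) [LieRing 𝔤] [LieAlgebra ℝ 𝔤] : Prop :=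
  ∃ J : 𝔤 →ₗ[ℝ] 𝔤, IsComplexStructure J

/-! ### The Lie algebras of the classification -/

/-- The three-dimensional real Lie algebra with basis `e₁, e₂, e₃` (the standard basis, indexed by
`0, 1, 2`) and brackets
`[e₁, e₂] = a e₂ + c e₃`, `[e₁, e₃] = b e₂ + d e₃`, `[e₂, e₃] = 0`. -/
def PlaneExtension (_a _b _c _d : ℝ) : Type := Fin 3 → ℝ

namespace PlaneExtension

instance (a b c d : ℝ) : AddCommGroup (PlaneExtension a b c d) :=
  inferInstanceAs (AddCommGroup (Fin 3 → ℝ))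

instance (a b c d : ℝ) : Module ℝ (PlaneExtension a b c d) :=
  inferInstanceAs (Module ℝ (Fin 3 → ℝ))

/-- The bilinear extension of the bracket relations. -/
def bracketFun (a b c d : ℝ) (x y : Fin 3 → ℝ) : Fin 3 → ℝ :=
  ![0,
    a * (x 0 * y 1 - x 1 * y 0) + b * (x 0 * y 2 - x 2 * y 0),
    c * (x 0 * y 1 - x 1 * y 0) + d * (x 0 * y 2 - x 2 * y 0)]

theorem bracketFun_add_left (a b c d : ℝ) (x y z : Fin 3 → ℝ) :
    bracketFun a b c d (x + y) z = bracketFun a b c d x z + bracketFun a b c d y z := by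
  ext i; fin_cases i <;> simp [bracketFun] <;> ring

theorem bracketFun_add_right (a b c d : ℝ) (x y z : Fin 3 → ℝ) :
    bracketFun a b c d x (y + z) = bracketFun a b c d x y + bracketFun a b c d x z := by
  ext i; fin_cases i <;> simp [bracketFun] <;> ring

theorem bracketFun_self (a b c d : ℝ) (x : Fin 3 → ℝ) : bracketFun a b c d x x = 0 := by
  ext i; fin_cases i <;> simp [bracketFun] <;> ring

theorem bracketFun_leibniz (a b c d : ℝ) (x y z : Fin 3 → ℝ) :
    bracketFun a b c d x (bracketFun a b c d y z) =
      bracketFun a b c d (bracketFun a b c d x y) z +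
        bracketFun a b c d y (bracketFun a b c d x z) := by
  ext i; fin_cases i <;> simp [bracketFun] <;> ring

theorem bracketFun_smul (a b c d t : ℝ) (x y : Fin 3 → ℝ) :
    bracketFun a b c d x (t • y) = t • bracketFun a b c d x y := by
  ext i; fin_cases i <;> simp [bracketFun] <;> ring

instance (a b c d : ℝ) : LieRing (PlaneExtension a b c d) where
  bracket := bracketFun a b c d
  add_lie := bracketFun_add_left a b c d
  lie_add := bracketFun_add_right a b c d
  lie_self := bracketFun_self a b c d
  leibniz_lie := bracketFun_leibniz a b c d

instance (a b c d : ℝ) : LieAlgebra ℝ (PlaneExtension a b c d) where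
  lie_smul := bracketFun_smul a b c d

end PlaneExtension

/-- The Heisenberg Lie algebra `𝔥₁`: `[e₁, e₂] = e₃`. -/
abbrev HeisenbergLie : Type := PlaneExtension 0 0 1 0

/-- The Lie algebra `𝔯_{3,μ}`: `[e₁, e₂] = e₂`, `[e₁, e₃] = μ e₃`. -/
abbrev R3Lie (μ : ℝ) : Type := PlaneExtension 1 0 0 μ

/-- The Lie algebra `𝔯'_{3,η}`: `[e₁, e₂] = η e₂ - e₃`, `[e₁, e₃] = e₂ + η e₃`. -/
abbrev R3PrimeLie (η : ℝ) : Type := PlaneExtension η 1 (-1) η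

/-- The two-dimensional Lie algebra `𝔞𝔣𝔣(ℝ)` of the group of affine motions of the line; the pair
`(s, v)` is the infinitesimal affine map `u ↦ s u + v`, that is the matrix `!![s, v; 0, 0]`, with the
commutator of matrices as bracket. -/
def AffLie : Type := ℝ × ℝ

namespace AffLie

instance : AddCommGroup AffLie := inferInstanceAs (AddCommGroup (ℝ × ℝ))

instance : Module ℝ AffLie := inferInstanceAs (Module ℝ (ℝ × ℝ))

/-- The commutator `[(s, v), (s', v')] = (0, s v' - s' v)`. -/
def bracketFun (x y : ℝ × ℝ) : ℝ × ℝ := (0, x.1 * y.2 - y.1 * x.2)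

theorem bracketFun_add_left (x y z : ℝ × ℝ) :
    bracketFun (x + y) z = bracketFun x z + bracketFun y z := by
  ext
  · simp [bracketFun]
  · simp [bracketFun]; ring

theorem bracketFun_add_right (x y z : ℝ × ℝ) :
    bracketFun x (y + z) = bracketFun x y + bracketFun x z := by
  ext
  · simp [bracketFun]
  · simp [bracketFun]; ring

theorem bracketFun_self (x : ℝ × ℝ) : bracketFun x x = 0 := by
  ext <;> simp [bracketFun]

theorem bracketFun_leibniz (x y z : ℝ × ℝ) :
    bracketFun x (bracketFun y z) =
      bracketFun (bracketFun x y) z + bracketFun y (bracketFun x z) := by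
  ext
  · simp [bracketFun]
  · simp [bracketFun]; ring

theorem bracketFun_smul (t : ℝ) (x y : ℝ × ℝ) :
    bracketFun x (t • y) = t • bracketFun x y := by
  ext
  · simp [bracketFun]
  · simp [bracketFun]; ring

instance : LieRing AffLie where
  bracket := bracketFun
  add_lie := bracketFun_add_left
  lie_add := bracketFun_add_right
  lie_self := bracketFun_self
  leibniz_lie := bracketFun_leibniz

instance : LieAlgebra ℝ AffLie where
  lie_smul := bracketFun_smul

end AffLie

/-!
A solvable Lie algebra `𝔥` of dimension three has a plane `K` containing the derived algebra. If `K`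
is not abelian, it is `𝔞𝔣𝔣(ℝ)`, all of whose derivations are inner, and `𝔥 ≅ ℝ × 𝔞𝔣𝔣(ℝ)`. If `K` is
abelian, `𝔥` is `PlaneExtension a b c d`, that is `ℝ e₁ ⋉_A ℝ²` for a matrix `A` which matters only up
to conjugation and a non-zero factor (`exists_equiv_planeExtension`,
`PlaneExtension.nonempty_equiv`). Non-real eigenvalues of `A` give `𝔯'_{3,η}`. Otherwise `A` is
triangular with real eigenvalues `l, m`, and the algebras not in the list are those with `l, m`
and `l + m` non-zero and `A` not scalar; `A` is then diagonalizable with `l ≠ m`, or a Jordan block.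

For these, `T*𝔥` has no complex structure `J` (`not_isComplexFor_cotBracket`). In `T*𝔥` the covector
`z = e¹` is central, so integrability makes `ad (J z)` commute with `J`. Let `D` be the action of
`e₁` on `V = span(e₂, e₃, e², e³)`, with eigenvalues `l, m, -l, -m`.

* If `J z` has a non-zero component `t` along `e₁`, then `t l` is an eigenvalue of `ad (J z)` with a
  one-dimensional eigenspace. This line is `J`-invariant, which is absurd
  (`cotBracket_transverse_false`).
* Otherwise the image of `ad (J z)`, being `J`-invariant, forces the component `v` of `J z` in `V` to
  be an eigenvector of `D` (`cotBracket_center_eigen`), non-zero because `J z` is not a multiple of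
  `z`. Symmetries of the bracket move `v` to a multiple of `e₂`. The centralizer of `J z` is then
  `J`-invariant, `J` induces a complex structure on the plane `v^⊥ / ⟨v⟩` spanned by `e₃` and `e³`,
  and integrability makes it commute with the action of `D`. But `D` has there the two distinct real
  eigenvalues `±m` (`cotBracket_eigenvector_false`).
-/

/-! ### Complex structures with respect to a bracket, and the cotangent bracket in coordinates -/

/-- `J` is a complex structure for the (not necessarily bundled) bracket `br`: `J² = -1` and the
Nijenhuis tensor of `J` formed with `br` vanishes. -/
structure IsComplexFor {V : Type*} [AddCommGroup V] [Module ℝ V] (br : V → V → V)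
    (J : V →ₗ[ℝ] V) : Prop where
  sq_eq_neg : ∀ x, J (J x) = -x
  integrable : ∀ x y, br (J x) (J y) - br x y - J (br (J x) y) - J (br x (J y)) = 0

theorem IsComplexStructure.isComplexFor {𝔤 : Type*} [LieRing 𝔤] [LieAlgebra ℝ 𝔤] {J : 𝔤 →ₗ[ℝ] 𝔤}
    (h : IsComplexStructure J) : IsComplexFor (fun x y => ⁅x, y⁆) J :=
  ⟨h.sq_eq_neg, h.integrable⟩

/-- Transport of a complex structure along a linear equivalence intertwining the brackets. -/
theorem IsComplexFor.conj {V W : Type*} [AddCommGroup V] [Module ℝ V] [AddCommGroup W] [Module ℝ W]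
    {br : V → V → V} {br' : W → W → W} {J : V →ₗ[ℝ] V} (h : IsComplexFor br J) (φ : V ≃ₗ[ℝ] W)
    (hφ : ∀ x y, φ (br x y) = br' (φ x) (φ y)) : IsComplexFor br' (φ.conj J) where
  sq_eq_neg x := by simp [LinearEquiv.conj_apply, h.sq_eq_neg]
  integrable x y := by
    have key := congrArg φ (h.integrable (φ.symm x) (φ.symm y))
    have e : ∀ p q, br p q = φ.symm (br' (φ p) (φ q)) := fun p q => by rw [← hφ]; simp
    simpa [LinearEquiv.conj_apply, e] using key

/-- The bracket of the cotangent algebra of `[e₁, e₂] = l e₂`, `[e₁, e₃] = b e₂ + m e₃`, in the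
coordinates belonging to the basis `e₁, e₂, e₃, e², e³, e¹`, where `e¹, e², e³` is the dual basis. -/
def cotBracket (l b m : ℝ) (p q : Fin 6 → ℝ) : Fin 6 → ℝ :=
  ![0,
    l * (p 0 * q 1 - p 1 * q 0) + b * (p 0 * q 2 - p 2 * q 0),
    m * (p 0 * q 2 - p 2 * q 0),
    -l * (p 0 * q 3 - p 3 * q 0),
    -b * (p 0 * q 3 - p 3 * q 0) - m * (p 0 * q 4 - p 4 * q 0),
    l * (p 1 * q 3 - p 3 * q 1) + b * (p 2 * q 3 - p 3 * q 2) + m * (p 2 * q 4 - p 4 * q 2)]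

/-- The central element `e¹`. -/
def cotCenter : Fin 6 → ℝ := ![0, 0, 0, 0, 0, 1]

/-- Since `z = e¹` is central, integrability at `(z, y)` says that `ad (J z)` commutes with `J`. -/
theorem IsComplexFor.cotBracket_center {l b m : ℝ} {J : (Fin 6 → ℝ) →ₗ[ℝ] (Fin 6 → ℝ)}
    (hJ : IsComplexFor (cotBracket l b m) J) (y : Fin 6 → ℝ) :
    cotBracket l b m (J cotCenter) (J y) = J (cotBracket l b m (J cotCenter) y) := by
  have h0 : ∀ w, cotBracket l b m cotCenter w = 0 := fun w => by
    ext i; fin_cases i <;> simp [cotBracket, cotCenter]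
  have := hJ.integrable cotCenter y
  rw [h0, h0, map_zero, sub_zero, sub_zero] at this
  exact sub_eq_zero.1 this

theorem apply_eq_sum_single (J : (Fin 6 → ℝ) →ₗ[ℝ] (Fin 6 → ℝ)) (v : Fin 6 → ℝ) (i : Fin 6) :
    J v i = v 0 * J (Pi.single 0 1) i + v 1 * J (Pi.single 1 1) i + v 2 * J (Pi.single 2 1) i
      + v 3 * J (Pi.single 3 1) i + v 4 * J (Pi.single 4 1) i + v 5 * J (Pi.single 5 1) i := by
  have h : v = ∑ j, v j • (Pi.single j 1 : Fin 6 → ℝ) := by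
    ext i; simp [Finset.sum_apply, Pi.single_apply]
  conv_lhs => rw [h]
  simp [Fin.sum_univ_six]

/-! ### Position of the image of the central element -/

/-- The image under `J` of the central element lies in the nilradical: otherwise `ad (J z)`, which
commutes with `J`, has a one-dimensional eigenspace. -/
theorem cotBracket_transverse_false {l b m : ℝ} {J : (Fin 6 → ℝ) →ₗ[ℝ] (Fin 6 → ℝ)}
    (hJ : IsComplexFor (cotBracket l b m) J) (hl : l ≠ 0) (hlm : l + m ≠ 0)
    (h : l ≠ m ∨ b ≠ 0) (hu : J cotCenter 0 ≠ 0) : False := by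
  set u := J cotCenter with hu_def
  -- The eigenvector `e₂ + s e¹` of `ad u` for the eigenvalue `u 0 * l`.
  let w : Fin 6 → ℝ := ![0, 1, 0, 0, 0, -u 3 / u 0]
  have huw : cotBracket l b m u w = (u 0 * l) • w := by
    ext i; fin_cases i <;> simp [cotBracket, w] <;> field_simp
  have hw := hJ.cotBracket_center w
  rw [← hu_def, huw, map_smul] at hw
  -- `J w` is an eigenvector for the same eigenvalue, hence a multiple of `w`.
  set v := J w with hv
  have e0 := congrFun hw 0
  have e1 := congrFun hw 1
  have e2 := congrFun hw 2
  have e3 := congrFun hw 3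
  have e4 := congrFun hw 4
  have e5 := congrFun hw 5
  simp [cotBracket] at e0 e1 e2 e3 e4 e5
  have v0 : v 0 = 0 := by tauto
  simp only [v0, mul_zero, sub_zero] at e1 e2 e3 e4
  have v3 : v 3 = 0 := by
    have : (u 0 * l) * v 3 = 0 := by linarith
    simpa [hu, hl] using this
  have v4 : v 4 = 0 := by
    have : (u 0 * (l + m)) * v 4 = 0 := by rw [v3] at e4; linarith
    simpa [hu, hlm] using this
  have v2 : v 2 = 0 := by
    have h1 : (u 0 * (l - m)) * v 2 = 0 := by linarith
    have h2 : (u 0 * b) * v 2 = 0 := by linarith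
    rcases h with h | h
    · simpa [hu, sub_ne_zero.2 h] using h1
    · simpa [hu, h] using h2
  have v5 : v 5 = v 1 * (-u 3 / u 0) := by
    rw [v2, v3, v4] at e5
    have : u 0 * l * (v 5 * u 0 + v 1 * u 3) = 0 := by linear_combination (-u 0) * e5
    have : v 5 * u 0 + v 1 * u 3 = 0 := by simpa [hu, hl] using this
    field_simp; linarith
  have hvw : v = v 1 • w := by
    ext i; fin_cases i <;> simp [w, v0, v2, v3, v4, v5]
  have hs := congrFun (hJ.sq_eq_neg w) 1
  rw [← hv, hvw, map_smul, ← hv] at hs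
  simp [w] at hs
  nlinarith [sq_nonneg (v 1)]

/-- The component of `J z` in `span(e₂, e₃, e², e³)` cannot be a non-zero multiple of `e₂`: the
complex structure induced on the plane `span(e₃, e³)`, which is the centralizer of `J z` modulo
`span(e₂, e¹)`, would commute with `ad e₁`, whose eigenvalues there are `m` and `-m`. -/
theorem cotBracket_eigenvector_false {l b m : ℝ} {J : (Fin 6 → ℝ) →ₗ[ℝ] (Fin 6 → ℝ)}
    (hJ : IsComplexFor (cotBracket l b m) J) (hl : l ≠ 0) (hm : m ≠ 0)
    (h0 : J cotCenter 0 = 0) (h1 : J cotCenter 1 ≠ 0) (h2 : J cotCenter 2 = 0)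
    (h3 : J cotCenter 3 = 0) (h4 : J cotCenter 4 = 0) : False := by
  have hz : cotCenter = Pi.single 5 1 := by ext i; fin_cases i <;> simp [cotCenter]
  have hcen := hJ.cotBracket_center
  have hJJz : ∀ i, J (J cotCenter) i = - cotCenter i := fun i => congrFun (hJ.sq_eq_neg _) i
  -- `J` preserves `span(e₂, e¹)`, because `J z` lies in it and is not a multiple of `z`.
  have hJX : ∀ i, i ≠ 5 → J cotCenter i = 0 → J (Pi.single 1 1) i = 0 := by
    intro i hi hi'
    have := hJJz i
    rw [apply_eq_sum_single, h0, h2, h3, h4, ← hz, hi', hz] at this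
    rw [hz] at h1
    simpa [h1, hi] using this
  have hX2 := hJX 2 (by decide) h2
  -- `J` preserves the centralizer of `J z`.
  have hY : ∀ v : Fin 6 → ℝ, v 0 = 0 → v 3 = 0 → J v 0 = 0 ∧ J v 3 = 0 := by
    intro v v0 v3
    have hv : cotBracket l b m (J cotCenter) v = 0 := by
      ext i; fin_cases i <;> simp [cotBracket, h0, h2, h3, h4, v0, v3]
    have := hcen v
    rw [hv, map_zero] at this
    have e1 := congrFun this 1
    have e5 := congrFun this 5
    simp [cotBracket, h0, h2, h3, h4, hl, h1] at e1 e5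
    exact ⟨e1, e5⟩
  -- Writing `J e₃ = p e₃ + p' e³` and `J e³ = q' e₃ + …` modulo `span(e₂, e¹)`, the coordinates
  -- along `e₃` give `p² + p' q' = -1` from `J² = -1` and `p² - p' q' = -1` from integrability at
  -- `(e₁, e₃)`.
  obtain ⟨hY0, hY3⟩ := hY (Pi.single 2 1) (by simp) (by simp)
  rw [hz] at h2
  have hs := congrFun (hJ.sq_eq_neg (Pi.single 2 1)) 2
  rw [apply_eq_sum_single, hY0, hY3, hX2, h2] at hs
  have hN := congrFun (hJ.integrable (Pi.single 0 1) (Pi.single 2 1)) 2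
  simp only [Pi.sub_apply] at hN
  rw [apply_eq_sum_single J (cotBracket _ _ _ _ _), apply_eq_sum_single J (cotBracket _ _ _ _ _)] at hN
  simp [cotBracket, hY0, hY3, hX2, h2] at hN hs
  set p := J (Pi.single 2 1) 2
  set q := J (Pi.single 2 1) 4 * J (Pi.single 4 1) 2
  have : m * (p * p - q + 1) = 0 := by simp only [p, q]; linear_combination -hN
  have : p * p - q + 1 = 0 := by simpa [hm] using this
  nlinarith [sq_nonneg p]

/-- If `J z` lies in the nilradical, its component in `span(e₂, e₃, e², e³)` is zero or an
eigenvector of `ad e₁`. -/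
theorem cotBracket_center_eigen {l b m : ℝ} {J : (Fin 6 → ℝ) →ₗ[ℝ] (Fin 6 → ℝ)}
    (hJ : IsComplexFor (cotBracket l b m) J) (h0 : J cotCenter 0 = 0) :
    ∃ r : ℝ, l * J cotCenter 1 + b * J cotCenter 2 = r * J cotCenter 1 ∧
      m * J cotCenter 2 = r * J cotCenter 2 ∧ -l * J cotCenter 3 = r * J cotCenter 3 ∧
      -b * J cotCenter 3 - m * J cotCenter 4 = r * J cotCenter 4 := by
  set u := J cotCenter with hu
  set A := J (Pi.single 0 1) with hA
  set d := cotBracket l b m u (Pi.single 0 1) with hd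
  set k := cotBracket l b m u A 5 with hk
  have h := hJ.cotBracket_center (Pi.single 0 1)
  have e : cotBracket l b m u A = A 0 • d + k • cotCenter := by
    ext i
    by_cases hi : i = 5
    · subst hi
      simp [hk, hd, cotBracket, cotCenter]
    · fin_cases i <;> first
        | exact absurd rfl hi
        | (simp [hd, cotBracket, cotCenter, h0] <;> ring)
  rw [← hu, ← hA, ← hd, e] at h
  -- `J d = A 0 • d + k • z` for `d = [J z, e₁]`; applying `J` once more expresses `d` through `J z`
  -- and `z`.
  have h' := congrArg J h
  rw [hJ.sq_eq_neg, map_add, map_smul, map_smul, ← h, ← hu] at h'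
  have hpos : 1 + A 0 * A 0 ≠ 0 := by nlinarith [sq_nonneg (A 0)]
  have e1 := congrFun h' 1
  have e2 := congrFun h' 2
  have e3 := congrFun h' 3
  have e4 := congrFun h' 4
  simp [hd, cotBracket, cotCenter, h0] at e1 e2 e3 e4
  refine ⟨k / (1 + A 0 * A 0), ?_, ?_, ?_, ?_⟩ <;> field_simp <;> linarith

/-! ### Symmetries of the cotangent bracket, and the obstruction -/

/-- Transport of a complex structure along a permutation of the coordinates which fixes the central
element and takes the bracket to the bracket with other parameters. -/
theorem IsComplexFor.reindex {l b m l' b' m' : ℝ} {J : (Fin 6 → ℝ) →ₗ[ℝ] (Fin 6 → ℝ)}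
    (hJ : IsComplexFor (cotBracket l b m) J) (σ : Equiv.Perm (Fin 6)) (h5 : cotCenter ∘ σ = cotCenter)
    (h : ∀ p q, cotBracket l b m p q ∘ σ = cotBracket l' b' m' (p ∘ σ) (q ∘ σ)) :
    ∃ J' : (Fin 6 → ℝ) →ₗ[ℝ] (Fin 6 → ℝ), IsComplexFor (cotBracket l' b' m') J' ∧
      ∀ i, J' cotCenter i = J cotCenter (σ i) := by
  refine ⟨_, hJ.conj (LinearEquiv.funCongrLeft ℝ ℝ σ) h, fun i => ?_⟩
  have : (LinearEquiv.funCongrLeft ℝ ℝ σ).symm cotCenter = cotCenter := by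
    rw [LinearEquiv.symm_apply_eq]; exact h5.symm
  rw [LinearEquiv.conj_apply_apply, this]
  rfl

/-- The symmetry exchanging `e₂` with `e₃` and `e²` with `e³`. -/
theorem IsComplexFor.swap_diag {l m : ℝ} {J : (Fin 6 → ℝ) →ₗ[ℝ] (Fin 6 → ℝ)}
    (hJ : IsComplexFor (cotBracket l 0 m) J) :
    ∃ J' : (Fin 6 → ℝ) →ₗ[ℝ] (Fin 6 → ℝ), IsComplexFor (cotBracket m 0 l) J' ∧
      ∀ i, J' cotCenter i = J cotCenter ((Equiv.swap 1 2 * Equiv.swap 3 4 : Equiv.Perm (Fin 6)) i) :=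
  hJ.reindex _ (by ext i; fin_cases i <;> simp [cotCenter] <;> rfl) fun p q => by
    ext i
    fin_cases i
    all_goals simp [cotBracket, Equiv.swap_apply_def]
    all_goals ring

/-- The symmetry exchanging `e₂` with `e²`. -/
theorem IsComplexFor.neg_diag {l m : ℝ} {J : (Fin 6 → ℝ) →ₗ[ℝ] (Fin 6 → ℝ)}
    (hJ : IsComplexFor (cotBracket l 0 m) J) :
    ∃ J' : (Fin 6 → ℝ) →ₗ[ℝ] (Fin 6 → ℝ), IsComplexFor (cotBracket (-l) 0 m) J' ∧
      ∀ i, J' cotCenter i = J cotCenter ((Equiv.swap 1 3 : Equiv.Perm (Fin 6)) i) :=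
  hJ.reindex _ (by ext i; fin_cases i <;> simp [cotCenter] <;> rfl) fun p q => by
    ext i
    fin_cases i
    all_goals simp [cotBracket, Equiv.swap_apply_def]
    all_goals ring

/-- The symmetry exchanging `e₂` with `e³` and `e₃` with `e²`, that is, replacing the matrix by its
negative transpose. The crossed pairing keeps the matrix triangular. -/
theorem IsComplexFor.dual {l b m : ℝ} {J : (Fin 6 → ℝ) →ₗ[ℝ] (Fin 6 → ℝ)}
    (hJ : IsComplexFor (cotBracket l b m) J) :
    ∃ J' : (Fin 6 → ℝ) →ₗ[ℝ] (Fin 6 → ℝ), IsComplexFor (cotBracket (-m) (-b) (-l)) J' ∧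
      ∀ i, J' cotCenter i = J cotCenter ((Equiv.swap 1 4 * Equiv.swap 2 3 : Equiv.Perm (Fin 6)) i) :=
  hJ.reindex _ (by ext i; fin_cases i <;> simp [cotCenter] <;> rfl) fun p q => by
    ext i
    fin_cases i
    all_goals simp [cotBracket, Equiv.swap_apply_def]
    all_goals ring

/-- The cotangent bracket of a non-scalar matrix with real eigenvalues `l, m` has no complex structure
if `l`, `m` and `l + m` are non-zero. The matrix is taken to be diagonal or a Jordan block. -/
theorem not_isComplexFor_cotBracket {l b m : ℝ} (hl : l ≠ 0) (hm : m ≠ 0) (hlm : l + m ≠ 0)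
    (h : b = 0 ∧ l ≠ m ∨ l = m ∧ b ≠ 0) (J : (Fin 6 → ℝ) →ₗ[ℝ] (Fin 6 → ℝ)) :
    ¬ IsComplexFor (cotBracket l b m) J := by
  intro hJ
  by_cases h0 : J cotCenter 0 = 0
  swap
  · exact cotBracket_transverse_false hJ hl hlm (by tauto) h0
  obtain ⟨r, r1, r2, r3, r4⟩ := cotBracket_center_eigen hJ h0
  have hne : ¬ (J cotCenter 1 = 0 ∧ J cotCenter 2 = 0 ∧ J cotCenter 3 = 0 ∧ J cotCenter 4 = 0) := by
    rintro ⟨h1, h2, h3, h4⟩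
    have hu : J cotCenter = J cotCenter 5 • cotCenter := by
      ext i
      have hi : cotCenter i = if i = 5 then 1 else 0 := by fin_cases i <;> rfl
      rw [Pi.smul_apply, hi]
      fin_cases i <;> simp [h0, h1, h2, h3, h4]
    have hs := congrFun (hJ.sq_eq_neg cotCenter) 5
    rw [hu, map_smul, Pi.smul_apply, Pi.neg_apply, show cotCenter 5 = 1 from rfl, smul_eq_mul] at hs
    nlinarith [sq_nonneg (J cotCenter 5)]
  have cancel : ∀ {s x : ℝ}, s * x = r * x → s ≠ r → x = 0 := by
    intro s x hx hs
    have : (s - r) * x = 0 := by linarith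
    simpa [sub_ne_zero.2 hs] using this
  have uniq : ∀ {s x : ℝ}, s * x = r * x → x ≠ 0 → s = r := by
    intro s x hx hs
    exact mul_right_cancel₀ hs hx
  rcases h with ⟨rfl, hd⟩ | ⟨rfl, hb⟩
  · replace r1 : l * J cotCenter 1 = r * J cotCenter 1 := by linarith
    replace r4 : -m * J cotCenter 4 = r * J cotCenter 4 := by linarith
    by_cases c1 : J cotCenter 1 = 0
    · by_cases c2 : J cotCenter 2 = 0
      · by_cases c3 : J cotCenter 3 = 0
        · have c4 : J cotCenter 4 ≠ 0 := fun c4 => hne ⟨c1, c2, c3, c4⟩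
          obtain ⟨J', hJ', e⟩ := hJ.dual
          rw [neg_zero] at hJ'
          refine cotBracket_eigenvector_false hJ' (neg_ne_zero.2 hm) (neg_ne_zero.2 hl) ?_ ?_ ?_ ?_ ?_ <;>
            rw [e] <;> assumption
        · have := uniq r3 c3
          have c4 : J cotCenter 4 = 0 := cancel r4 fun h => hd (by linarith)
          obtain ⟨J', hJ', e⟩ := hJ.neg_diag
          refine cotBracket_eigenvector_false hJ' (neg_ne_zero.2 hl) hm ?_ ?_ ?_ ?_ ?_ <;>
            rw [e] <;> assumption
      · have := uniq r2 c2
        have c3 : J cotCenter 3 = 0 := cancel r3 fun h => hlm (by linarith)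
        have c4 : J cotCenter 4 = 0 := cancel r4 fun h => hm (by linarith)
        obtain ⟨J', hJ', e⟩ := hJ.swap_diag
        refine cotBracket_eigenvector_false hJ' hm hl ?_ ?_ ?_ ?_ ?_ <;>
          rw [e] <;> assumption
    · have := uniq r1 c1
      have c2 : J cotCenter 2 = 0 := cancel r2 fun h => hd (by linarith)
      have c3 : J cotCenter 3 = 0 := cancel r3 fun h => hl (by linarith)
      have c4 : J cotCenter 4 = 0 := cancel r4 fun h => hlm (by linarith)
      exact cotBracket_eigenvector_false hJ hl hm h0 c1 c2 c3 c4
  · have c2 : J cotCenter 2 = 0 := by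
      by_contra c2
      rw [uniq r2 c2] at r1
      exact c2 (by simpa [hb] using r1)
    have c3 : J cotCenter 3 = 0 := by
      by_contra c3
      rw [← uniq r3 c3] at r4
      exact c3 (by simpa [hb] using (by linarith : b * J cotCenter 3 = 0))
    rw [c2, mul_zero, add_zero] at r1
    replace r4 : -l * J cotCenter 4 = r * J cotCenter 4 := by rw [c3] at r4; linarith
    by_cases c1 : J cotCenter 1 = 0
    · have c4 : J cotCenter 4 ≠ 0 := fun c4 => hne ⟨c1, c2, c3, c4⟩
      obtain ⟨J', hJ', e⟩ := hJ.dual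
      refine cotBracket_eigenvector_false hJ' (neg_ne_zero.2 hl) (neg_ne_zero.2 hl) ?_ ?_ ?_ ?_ ?_ <;>
        rw [e] <;> assumption
    · have := uniq r1 c1
      have c4 : J cotCenter 4 = 0 := cancel r4 fun h => hl (by linarith)
      exact cotBracket_eigenvector_false hJ hl hm h0 c1 c2 c3 c4

/-! ### Coordinates on the cotangent algebra -/

theorem PlaneExtension.lie_eq (a b c d : ℝ) (x y : PlaneExtension a b c d) :
    ⁅x, y⁆ = (PlaneExtension.bracketFun a b c d x y : PlaneExtension a b c d) := rfl

theorem cotBracket_equiv {𝔥 : Type*} [LieRing 𝔥] [LieAlgebra ℝ 𝔥] {l b m : ℝ}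
    (ψ : 𝔥 ≃ₗ⁅ℝ⁆ PlaneExtension l b 0 m) :
    ∃ φ : CotangentLie 𝔥 ≃ₗ[ℝ] (Fin 6 → ℝ), ∀ x y, φ ⁅x, y⁆ = cotBracket l b m (φ x) (φ y) := by
  let ψ' : 𝔥 ≃ₗ[ℝ] (Fin 3 → ℝ) := ψ.toLinearEquiv
  have hψ : ∀ x y, ψ' ⁅x, y⁆ = PlaneExtension.bracketFun l b 0 m (ψ' x) (ψ' y) :=
    fun x y => ψ.map_lie x y
  let B : Module.Basis (Fin 3) ℝ 𝔥 := Module.Basis.ofEquivFun ψ'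
  -- Reordering of the coordinates: `e₁, e₂, e₃` first, then `e², e³, e¹`.
  let θ : ((Fin 3 → ℝ) × (Fin 3 → ℝ)) ≃ₗ[ℝ] (Fin 6 → ℝ) :=
    { toFun := fun p => ![p.2 0, p.2 1, p.2 2, p.1 1, p.1 2, p.1 0]
      invFun := fun v => (![v 5, v 3, v 4], ![v 0, v 1, v 2])
      map_add' := fun p q => by ext i; fin_cases i <;> simp
      map_smul' := fun t p => by ext i; fin_cases i <;> simp
      left_inv := fun p => by ext i <;> fin_cases i <;> simp
      right_inv := fun v => by ext i; fin_cases i <;> simp }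
  let δ : AbelianLie (Module.Dual ℝ 𝔥) ≃ₗ[ℝ] (Fin 3 → ℝ) := B.dualBasis.equivFun
  have hδ : ∀ (ξ : Module.Dual ℝ 𝔥) i, δ ξ i = ξ (B i) := fun ξ i => by
    change B.dualBasis.repr ξ i = _
    simp
  have hξ : ∀ (ξ : Module.Dual ℝ 𝔥) x,
      ξ x = ψ' x 0 * ξ (B 0) + ψ' x 1 * ξ (B 1) + ψ' x 2 * ξ (B 2) := by
    intro ξ x
    have : ξ x = ξ (∑ i, ψ' x i • B i) := by
      congr 1
      exact (B.sum_equivFun x).symm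
    rw [this]
    simp [Fin.sum_univ_three]
  have hB : ∀ i, ψ' (B i) = Pi.single i 1 := fun i => by simp [B, Module.Basis.ofEquivFun]
  let φ : CotangentLie 𝔥 ≃ₗ[ℝ] (Fin 6 → ℝ) :=
    (LieAlgebra.SemiDirectSum.toProdl _).trans ((LinearEquiv.prodCongr δ ψ').trans θ)
  have hφ : ∀ (ξ : Module.Dual ℝ 𝔥) (x : 𝔥), φ ⟨ξ, x⟩ =
      ![ψ' x 0, ψ' x 1, ψ' x 2, ξ (B 1), ξ (B 2), ξ (B 0)] := by
    intro ξ x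
    simp only [← hδ]
    rfl
  have hbr : ∀ (ξ ξ' : Module.Dual ℝ 𝔥) (x x' : 𝔥),
      (⁅(⟨ξ, x⟩ : CotangentLie 𝔥), (⟨ξ', x'⟩ : CotangentLie 𝔥)⁆ : CotangentLie 𝔥) =
        ⟨(⁅x, ξ'⁆ - ⁅x', ξ⁆ : Module.Dual ℝ 𝔥), ⁅x, x'⁆⟩ := by
    intro ξ ξ' x x'
    rw [LieAlgebra.SemiDirectSum.lie_eq_mk]
    congr 1
    exact congrArg (· - ⁅x', ξ⁆) (zero_add ⁅x, ξ'⁆)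
  have key : ∀ (ξ ξ' : Module.Dual ℝ 𝔥) (x x' : 𝔥),
      φ ⁅(⟨ξ, x⟩ : CotangentLie 𝔥), (⟨ξ', x'⟩ : CotangentLie 𝔥)⁆ =
        cotBracket l b m (φ ⟨ξ, x⟩) (φ ⟨ξ', x'⟩) := by
    intro ξ ξ' x x'
    rw [hbr, hφ, hφ, hφ]
    ext i
    simp only [LinearMap.sub_apply, Module.Dual.lie_apply]
    fin_cases i <;>
      simp [cotBracket, hξ _ ⁅_, _⁆, hψ, PlaneExtension.bracketFun, hB] <;> ring
  exact ⟨φ, fun ⟨ξ, x⟩ ⟨ξ', x'⟩ => key ξ ξ' x x'⟩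

/-! ### Three-dimensional solvable Lie algebras -/

section LieEquiv
variable {𝔥 : Type*} [LieRing 𝔥] [LieAlgebra ℝ 𝔥]

theorem linearIndependent_three_iff {V : Type*} [AddCommGroup V] [Module ℝ V] {x y z : V} :
    LinearIndependent ℝ ![x, y, z] ↔
      ∀ r s t : ℝ, r • x + s • y + t • z = 0 → r = 0 ∧ s = 0 ∧ t = 0 := by
  rw [Fintype.linearIndependent_iff]
  constructor
  · intro h r s t e
    have := h ![r, s, t] (by simpa [Fin.sum_univ_three] using e)
    exact ⟨this 0, this 1, this 2⟩
  · intro h g e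
    obtain ⟨h0, h1, h2⟩ := h (g 0) (g 1) (g 2) (by simpa [Fin.sum_univ_three] using e)
    intro i
    fin_cases i <;> assumption

theorem nonempty_equiv_planeExtension {a b c d : ℝ} (hdim : Module.finrank ℝ 𝔥 = 3) {x y z : 𝔥}
    (hli : LinearIndependent ℝ ![x, y, z]) (hxy : ⁅x, y⁆ = a • y + c • z)
    (hxz : ⁅x, z⁆ = b • y + d • z) (hyz : ⁅y, z⁆ = 0) :
    Nonempty (𝔥 ≃ₗ⁅ℝ⁆ PlaneExtension a b c d) := by
  let B := basisOfLinearIndependentOfCardEqFinrank hli (by simp [hdim])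
  have hB : ∀ u, u = B.equivFun u 0 • x + B.equivFun u 1 • y + B.equivFun u 2 • z := by
    intro u
    conv_lhs => rw [← B.sum_equivFun u]
    simp [Fin.sum_univ_three, B]
  have hB' : ∀ r s t : ℝ, B.equivFun (r • x + s • y + t • z) = ![r, s, t] := by
    intro r s t
    rw [← LinearEquiv.eq_symm_apply]
    simp [Module.Basis.equivFun_symm_apply, Fin.sum_univ_three, B]
  refine ⟨{ (B.equivFun : 𝔥 ≃ₗ[ℝ] (Fin 3 → ℝ)) with
    toFun := fun u => (B.equivFun u : Fin 3 → ℝ)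
    invFun := fun v => B.equivFun.symm v
    map_lie' := ?_ }⟩
  intro u v
  have hyx : ⁅y, x⁆ = -(a • y + c • z) := by rw [← hxy, lie_skew]
  have hzx : ⁅z, x⁆ = -(b • y + d • z) := by rw [← hxz, lie_skew]
  have hzy : ⁅z, y⁆ = 0 := by rw [← lie_skew, hyz, neg_zero]
  change B.equivFun ⁅u, v⁆ = PlaneExtension.bracketFun a b c d (B.equivFun u) (B.equivFun v)
  set p := B.equivFun u with hp
  set q := B.equivFun v with hq
  have : ⁅u, v⁆ = (0 : ℝ) • x + (a * (p 0 * q 1 - p 1 * q 0) + b * (p 0 * q 2 - p 2 * q 0)) • y +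
      (c * (p 0 * q 1 - p 1 * q 0) + d * (p 0 * q 2 - p 2 * q 0)) • z := by
    rw [hB u, hB v, ← hp, ← hq]
    simp only [lie_add, add_lie, lie_smul, smul_lie, lie_self, hxy, hxz, hyz, hyx, hzx, hzy]
    module
  rw [this, hB']
  rfl

/-- The new basis `s e₁, p e₂ + q e₃, r e₂ + t e₃` replaces the matrix by a conjugate multiple. -/
theorem PlaneExtension.nonempty_equiv {a b c d a' b' c' d' : ℝ} (s p q r t : ℝ) (hs : s ≠ 0)
    (hdet : p * t - q * r ≠ 0)
    (h1 : s * (p * a + q * b) = a' * p + c' * r) (h2 : s * (p * c + q * d) = a' * q + c' * t)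
    (h3 : s * (r * a + t * b) = b' * p + d' * r) (h4 : s * (r * c + t * d) = b' * q + d' * t) :
    Nonempty (PlaneExtension a b c d ≃ₗ⁅ℝ⁆ PlaneExtension a' b' c' d') := by
  refine nonempty_equiv_planeExtension (𝔥 := PlaneExtension a b c d)
    (x := (![s, 0, 0] : Fin 3 → ℝ)) (y := (![0, p, q] : Fin 3 → ℝ))
    (z := (![0, r, t] : Fin 3 → ℝ)) ?_ ?_ ?_ ?_ ?_
  · exact Module.finrank_fin_fun ℝ
  · change LinearIndependent ℝ ![(![s, 0, 0] : Fin 3 → ℝ), ![0, p, q], ![0, r, t]]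
    rw [linearIndependent_three_iff]
    intro u v w e
    have e0 := congrFun e 0
    have e1 := congrFun e 1
    have e2 := congrFun e 2
    simp [hs] at e0 e1 e2
    refine ⟨e0, ?_, ?_⟩
    · have : (p * t - q * r) * v = 0 := by linear_combination t * e1 - r * e2
      simpa [hdet] using this
    · have : (p * t - q * r) * w = 0 := by linear_combination p * e2 - q * e1
      simpa [hdet] using this
  · change PlaneExtension.bracketFun a b c d ![s, 0, 0] ![0, p, q] =
      a' • (![0, p, q] : Fin 3 → ℝ) + c' • (![0, r, t] : Fin 3 → ℝ)
    ext i; fin_cases i <;> simp [PlaneExtension.bracketFun] <;> linarith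
  · change PlaneExtension.bracketFun a b c d ![s, 0, 0] ![0, r, t] =
      b' • (![0, p, q] : Fin 3 → ℝ) + d' • (![0, r, t] : Fin 3 → ℝ)
    ext i; fin_cases i <;> simp [PlaneExtension.bracketFun] <;> linarith
  · change PlaneExtension.bracketFun a b c d ![0, p, q] ![0, r, t] = (0 : Fin 3 → ℝ)
    ext i; fin_cases i <;> simp [PlaneExtension.bracketFun]

theorem PlaneExtension.nonempty_equiv_real_prod_aff :
    Nonempty (PlaneExtension 1 0 0 0 ≃ₗ⁅ℝ⁆ (AbelianLie ℝ × AffLie)) := by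
  refine ⟨{ toFun := fun v => ((v 2 : ℝ), ((v 0 : ℝ), (v 1 : ℝ)))
            invFun := fun w => (![(w.2 : ℝ × ℝ).1, (w.2 : ℝ × ℝ).2, w.1] : Fin 3 → ℝ)
            map_add' := fun _ _ => rfl
            map_smul' := fun _ _ => rfl
            map_lie' := ?_
            left_inv := ?_
            right_inv := fun _ => rfl }⟩
  · intro x y
    have : PlaneExtension.bracketFun 1 0 0 0 x y = ![0, x 0 * y 1 - y 0 * x 1, 0] := by
      ext i; fin_cases i <;> simp [PlaneExtension.bracketFun]; ring
    change ((PlaneExtension.bracketFun 1 0 0 0 x y 2, (PlaneExtension.bracketFun 1 0 0 0 x y 0,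
      PlaneExtension.bracketFun 1 0 0 0 x y 1)) : ℝ × (ℝ × ℝ)) =
      (0, (0, x 0 * y 1 - y 0 * x 1))
    rw [this]
    rfl
  · intro v
    change (![v 0, v 1, v 2] : Fin 3 → ℝ) = v
    ext i; fin_cases i <;> rfl

/-- A plane containing the derived algebra, given by its basis `k₁, k₂` and a vector `e` outside. -/
theorem exists_plane_containing_derived (hdim : Module.finrank ℝ 𝔥 = 3)
    (hsolv : LieAlgebra.IsSolvable 𝔥) :
    ∃ e k₁ k₂ : 𝔥, LinearIndependent ℝ ![e, k₁, k₂] ∧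
      ∀ x y : 𝔥, ∃ p q : ℝ, ⁅x, y⁆ = p • k₁ + q • k₂ := by
  have : Module.Finite ℝ 𝔥 := Module.finite_of_finrank_pos (by omega)
  have : Nontrivial 𝔥 := Module.nontrivial_of_finrank_pos (R := ℝ) (by omega)
  have hlt := LieAlgebra.derivedSeries_lt_top_of_solvable ℝ 𝔥
  obtain ⟨f, hf, hker⟩ := Submodule.exists_le_ker_of_lt_top
    (LieAlgebra.derivedSeries ℝ 𝔥 1).toSubmodule (lt_top_iff_ne_top.2 fun h => hlt.ne (by simpa using h))
  have hfbr : ∀ x y : 𝔥, f ⁅x, y⁆ = 0 := fun x y =>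
    hker (LieSubmodule.lie_mem_lie (LieSubmodule.mem_top x) (LieSubmodule.mem_top y))
  have hK : Module.finrank ℝ (LinearMap.ker f) = 2 := by
    have := Module.Dual.finrank_ker_add_one_of_ne_zero hf
    omega
  let B := Module.finBasisOfFinrankEq ℝ (LinearMap.ker f) hK
  obtain ⟨e, he⟩ : ∃ e, f e ≠ 0 := by
    by_contra! h
    exact hf (LinearMap.ext h)
  refine ⟨e, B 0, B 1, ?_, fun x y => ?_⟩
  · rw [linearIndependent_three_iff]
    intro r s t h
    have hr : r = 0 := by
      have := congrArg f h
      simpa [LinearMap.mem_ker.1 (B 0).2, LinearMap.mem_ker.1 (B 1).2, he] using this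
    have hli := Fintype.linearIndependent_iff.1 B.linearIndependent ![s, t] (by
      ext
      simpa [hr] using h)
    exact ⟨hr, hli 0, hli 1⟩
  · let w : LinearMap.ker f := ⟨⁅x, y⁆, hfbr x y⟩
    have h := congrArg Subtype.val (B.sum_repr w)
    rw [Fin.sum_univ_two] at h
    exact ⟨_, _, h.symm⟩

/-- A solvable Lie algebra of dimension three is an extension of a line by an abelian plane. If a
plane `K` containing the derived algebra is not abelian itself, a complement of `K` can be corrected
by an element of `K` to become central, since the derivations of `K` are inner; then
`𝔥 ≅ PlaneExtension 1 0 0 0`. -/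
theorem exists_equiv_planeExtension (hdim : Module.finrank ℝ 𝔥 = 3)
    (hsolv : LieAlgebra.IsSolvable 𝔥) :
    ∃ a b c d : ℝ, Nonempty (𝔥 ≃ₗ⁅ℝ⁆ PlaneExtension a b c d) := by
  obtain ⟨e, k₁, k₂, hli, hbr⟩ := exists_plane_containing_derived hdim hsolv
  by_cases h0 : ⁅k₁, k₂⁆ = 0
  · obtain ⟨a, c, h1⟩ := hbr e k₁
    obtain ⟨b, d, h2⟩ := hbr e k₂
    exact ⟨a, b, c, d, nonempty_equiv_planeExtension hdim hli h1 h2 h0⟩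
  obtain ⟨p, q, hw⟩ := hbr k₁ k₂
  rw [linearIndependent_three_iff] at hli
  -- A basis `u, v` of `K` with `[u, v] = v`, where `v` spans `[K, K]`.
  obtain ⟨u, v, huv, hli', hbr'⟩ : ∃ u v : 𝔥, ⁅u, v⁆ = v ∧
      (∀ r s t : ℝ, r • e + s • u + t • v = 0 → r = 0 ∧ s = 0 ∧ t = 0) ∧
      ∀ x y : 𝔥, ∃ p q : ℝ, ⁅x, y⁆ = p • u + q • v := by
    have hkk : ⁅k₂, k₁⁆ = -(p • k₁ + q • k₂) := by rw [← hw, lie_skew]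
    by_cases hq : q = 0
    · subst hq
      have hp : p ≠ 0 := by rintro rfl; simp [hw] at h0
      refine ⟨(-p⁻¹) • k₂, k₁, ?_, fun r s t h => ?_, fun x y => ?_⟩
      · rw [smul_lie, hkk]; simp [smul_smul, hp]
      · obtain ⟨h1, h2, h3⟩ := hli r t (s * -p⁻¹) (by rw [← h]; module)
        exact ⟨h1, by simpa [hp] using h3, h2⟩
      · obtain ⟨i, j, h⟩ := hbr x y
        refine ⟨-p * j, i, ?_⟩
        rw [h, smul_smul]
        have : -p * j * -p⁻¹ = j := by field_simp
        rw [this, add_comm]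
    · refine ⟨q⁻¹ • k₁, p • k₁ + q • k₂, ?_, fun r s t h => ?_, fun x y => ?_⟩
      · rw [smul_lie, lie_add, lie_smul, lie_smul, lie_self, hw, smul_zero, zero_add, smul_smul,
          inv_mul_cancel₀ hq, one_smul]
      · obtain ⟨h1, h2, h3⟩ := hli r (s * q⁻¹ + t * p) (t * q) (by rw [← h]; module)
        have ht : t = 0 := by simpa [hq] using h3
        exact ⟨h1, by simpa [ht, hq] using h2, ht⟩
      · obtain ⟨i, j, h⟩ := hbr x y
        refine ⟨q * i - j * p, j * q⁻¹, ?_⟩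
        rw [h]
        match_scalars <;> field_simp
        ring
  obtain ⟨α, β, hu⟩ := hbr' e u
  obtain ⟨γ, κ, hv⟩ := hbr' e v
  have hvu : ⁅v, u⁆ = -v := by rw [← lie_skew, huv]
  -- As `ad e` is a derivation, it maps `v = [u, v]`, and then also `u`, to multiples of `v`.
  have hJac := leibniz_lie e u v
  rw [huv, hv, hu, add_lie, lie_add, smul_lie, smul_lie, lie_smul, lie_smul, lie_self, lie_self, huv]
    at hJac
  obtain ⟨-, hγ, hα⟩ := hli' 0 γ (-α) (by
    have : (0 : ℝ) • e + γ • u + (-α) • v = (γ • u + κ • v) -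
        (α • v + β • (0 : 𝔥) + (γ • (0 : 𝔥) + κ • v)) := by module
    rw [this, ← hJac, sub_self])
  replace hα : α = 0 := by linarith
  subst hγ hα
  rw [zero_smul, zero_add] at hu hv
  -- The vector `e - κ u + β v` is central.
  refine ⟨1, 0, 0, 0, nonempty_equiv_planeExtension hdim (x := u) (y := v) (z := e - κ • u + β • v)
    ?_ ?_ ?_ ?_⟩
  · rw [linearIndependent_three_iff]
    intro r s t h
    obtain ⟨h1, h2, h3⟩ := hli' t (r - t * κ) (s + t * β) (by rw [← h]; module)
    subst h1
    exact ⟨by linarith, by linarith, rfl⟩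
  · rw [huv]; module
  · rw [lie_add, lie_sub, lie_smul, lie_smul, lie_self, huv, ← lie_skew, hu]; module
  · rw [lie_add, lie_sub, lie_smul, lie_smul, lie_self, hvu, ← lie_skew, hv]; module

end LieEquiv

/-! ### Normal forms of the matrix -/

theorem PlaneExtension.nonempty_equiv_r3Prime {a b c d : ℝ} (h : (a - d) ^ 2 + 4 * (b * c) < 0) :
    ∃ η : ℝ, 0 ≤ η ∧ Nonempty (PlaneExtension a b c d ≃ₗ⁅ℝ⁆ R3PrimeLie η) := by
  -- The factor `s` makes the imaginary parts of the eigenvalues `±1`; its sign is chosen so that their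
  -- real part is non-negative.
  obtain ⟨s, hs, hη⟩ : ∃ s : ℝ, s ^ 2 * (4 * (a * d - b * c) - (a + d) ^ 2) = 4 ∧
      0 ≤ s * (a + d) := by
    have hpos : 0 < 4 * (a * d - b * c) - (a + d) ^ 2 := by linarith
    have hsq := Real.sq_sqrt hpos.le
    have hne : √(4 * (a * d - b * c) - (a + d) ^ 2) ≠ 0 := (Real.sqrt_pos.2 hpos).ne'
    set β := √(4 * (a * d - b * c) - (a + d) ^ 2)
    rcases le_total 0 (2 / β * (a + d)) with h | h
    · exact ⟨2 / β, by rw [← hsq]; field_simp; norm_num, h⟩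
    · exact ⟨-(2 / β), by rw [← hsq]; field_simp; norm_num, by linarith⟩
  have hs0 : s ≠ 0 := by rintro rfl; norm_num at hs
  have hc : c ≠ 0 := by rintro rfl; nlinarith [sq_nonneg (a - d)]
  -- The second basis vector is arbitrary; the third is forced by the first relation, and the second
  -- relation is then the Cayley-Hamilton theorem for `s • !![a, b; c, d]`.
  refine ⟨s * (a + d) / 2, by linarith, PlaneExtension.nonempty_equiv s 1 0
    (s * (a + d) / 2 - s * a) (-(s * c)) hs0 (by simp [hs0, hc]) ?_ ?_ ?_ ?_⟩
  · ring
  · ring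
  · linear_combination (1 / 4) * hs
  · ring

theorem PlaneExtension.nonempty_equiv_triangular {a b c d : ℝ}
    (h : 0 ≤ (a - d) ^ 2 + 4 * (b * c)) :
    ∃ l b' m : ℝ, Nonempty (PlaneExtension a b c d ≃ₗ⁅ℝ⁆ PlaneExtension l b' 0 m) := by
  by_cases hc : c = 0
  · subst hc
    exact ⟨a, b, d, ⟨LieEquiv.refl⟩⟩
  · have hsq := Real.sq_sqrt h
    -- The eigenvector `(l - d, c)` for a root `l` of the characteristic polynomial.
    set l := (a + d + √((a - d) ^ 2 + 4 * (b * c))) / 2 with hl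
    have hchar : (l - d) * a + c * b = l * (l - d) := by
      rw [hl]; linear_combination (-1 / 4) * hsq
    exact ⟨l, 1, a + d - l, PlaneExtension.nonempty_equiv 1 (l - d) c 1 0 one_ne_zero (by simp [hc])
      (by linarith) (by ring) (by ring) (by ring)⟩

/-! ### The classification -/

theorem not_admitsComplexStructure_cotangentLie {𝔥 : Type*} [LieRing 𝔥] [LieAlgebra ℝ 𝔥]
    {l b m : ℝ} (hl : l ≠ 0) (hm : m ≠ 0) (hlm : l + m ≠ 0)
    (h : b = 0 ∧ l ≠ m ∨ l = m ∧ b ≠ 0) (ψ : 𝔥 ≃ₗ⁅ℝ⁆ PlaneExtension l b 0 m) :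
    ¬ AdmitsComplexStructure (CotangentLie 𝔥) := by
  rintro ⟨J, hJ⟩
  obtain ⟨φ, hφ⟩ := cotBracket_equiv ψ
  exact not_isComplexFor_cotBracket hl hm hlm h _ (hJ.isComplexFor.conj φ hφ)

theorem mainTheorem3 (𝔥 : Type*) [LieRing 𝔥] [LieAlgebra ℝ 𝔥]
    (hdim : Module.finrank ℝ 𝔥 = 3)
    (hsolv : LieAlgebra.IsSolvable 𝔥)
    (hnonab : ¬ IsLieAbelian 𝔥)
    (hJ : AdmitsComplexStructure (CotangentLie 𝔥)) :
    Nonempty (𝔥 ≃ₗ⁅ℝ⁆ HeisenbergLie) ∨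
      Nonempty (𝔥 ≃ₗ⁅ℝ⁆ (AbelianLie ℝ × AffLie)) ∨
      Nonempty (𝔥 ≃ₗ⁅ℝ⁆ R3Lie 1) ∨
      Nonempty (𝔥 ≃ₗ⁅ℝ⁆ R3Lie (-1)) ∨
      ∃ η : ℝ, 0 ≤ η ∧ Nonempty (𝔥 ≃ₗ⁅ℝ⁆ R3PrimeLie η) := by
  obtain ⟨a, b₀, c, d, ⟨ψ₀⟩⟩ := exists_equiv_planeExtension hdim hsolv
  rcases lt_or_ge ((a - d) ^ 2 + 4 * (b₀ * c)) 0 with hdisc | hdisc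
  · obtain ⟨η, hη, ⟨χ⟩⟩ := PlaneExtension.nonempty_equiv_r3Prime hdisc
    exact .inr (.inr (.inr (.inr ⟨η, hη, ⟨ψ₀.trans χ⟩⟩)))
  obtain ⟨l, b, m, ⟨χ⟩⟩ := PlaneExtension.nonempty_equiv_triangular hdisc
  have ψ := ψ₀.trans χ
  by_cases hl : l = 0
  · subst hl
    by_cases hm : m = 0
    · subst hm
      by_cases hb : b = 0
      · subst hb
        refine absurd ⟨fun x y => ψ.injective ?_⟩ hnonab
        rw [LieHom.map_lie, map_zero]
        change PlaneExtension.bracketFun 0 0 0 0 _ _ = 0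
        ext i; fin_cases i <;> simp [PlaneExtension.bracketFun]
      · obtain ⟨χ'⟩ : Nonempty (PlaneExtension 0 b 0 0 ≃ₗ⁅ℝ⁆ HeisenbergLie) :=
          PlaneExtension.nonempty_equiv 1 0 1 b 0 one_ne_zero (by simp [hb])
            (by ring) (by ring) (by ring) (by ring)
        exact .inl ⟨ψ.trans χ'⟩
    · obtain ⟨χ'⟩ : Nonempty (PlaneExtension 0 b 0 m ≃ₗ⁅ℝ⁆ PlaneExtension 1 0 0 0) :=
        PlaneExtension.nonempty_equiv m⁻¹ b m 1 0 (inv_ne_zero hm) (by simp [hm])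
          (by field_simp; ring) (by field_simp; ring) (by ring) (by ring)
      obtain ⟨χ''⟩ := PlaneExtension.nonempty_equiv_real_prod_aff
      exact .inr (.inl ⟨(ψ.trans χ').trans χ''⟩)
  by_cases hm : m = 0
  · subst hm
    obtain ⟨χ'⟩ : Nonempty (PlaneExtension l b 0 0 ≃ₗ⁅ℝ⁆ PlaneExtension 1 0 0 0) :=
      PlaneExtension.nonempty_equiv l⁻¹ 1 0 (-b / l) 1 (inv_ne_zero hl) (by simp)
        (by field_simp; ring) (by ring) (by field_simp; ring) (by ring)
    obtain ⟨χ''⟩ := PlaneExtension.nonempty_equiv_real_prod_aff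
    exact .inr (.inl ⟨(ψ.trans χ').trans χ''⟩)
  by_cases hlm : l = m
  · subst hlm
    by_cases hb : b = 0
    · subst hb
      obtain ⟨χ'⟩ : Nonempty (PlaneExtension l 0 0 l ≃ₗ⁅ℝ⁆ R3Lie 1) :=
        PlaneExtension.nonempty_equiv l⁻¹ 1 0 0 1 (inv_ne_zero hl) (by simp)
          (by field_simp; ring) (by ring) (by ring) (by field_simp; ring)
      exact .inr (.inr (.inl ⟨ψ.trans χ'⟩))
    · exact absurd hJ (not_admitsComplexStructure_cotangentLie hl hl (by simpa using hl)
        (.inr ⟨rfl, hb⟩) ψ)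
  have hml : m - l ≠ 0 := sub_ne_zero.2 (Ne.symm hlm)
  obtain ⟨χ'⟩ : Nonempty (PlaneExtension l b 0 m ≃ₗ⁅ℝ⁆ PlaneExtension l 0 0 m) :=
    PlaneExtension.nonempty_equiv 1 1 0 (b / (m - l)) 1 one_ne_zero (by simp)
      (by ring) (by ring) (by field_simp; ring) (by ring)
  by_cases hsum : l + m = 0
  · obtain rfl : m = -l := by linarith
    obtain ⟨χ''⟩ : Nonempty (PlaneExtension l 0 0 (-l) ≃ₗ⁅ℝ⁆ R3Lie (-1)) :=
      PlaneExtension.nonempty_equiv l⁻¹ 1 0 0 1 (inv_ne_zero hl) (by simp)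
        (by field_simp; ring) (by ring) (by ring) (by field_simp; ring)
    exact .inr (.inr (.inr (.inl ⟨(ψ.trans χ').trans χ''⟩)))
  · exact absurd hJ (not_admitsComplexStructure_cotangentLie hl hm hsum (.inl ⟨rfl, hlm⟩)
      (ψ.trans χ'))
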